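/- Let $S\subset\mathbf{R}^3$ be an (embedded) $C^\infty$ surface with boundary $\gamma=\partial S$, and put $\mathrm{Int}\,S=S\setminus\gamma$. Let $\widetilde S\subset\mathbf{R}^3$ be a flat $C^1$ extension of $S$, that is, an (embedded) $C^1$ surface without boundary such that $S\subset\widetilde S$, the set $S'=\widetilde S\setminus\mathrm{Int}\,S$ is a $C^\infty$ surface with boundary, and the Gaussian curvature of $S'$ vanishes identically. Suppose that the restriction $g|_\gamma$ to $\gamma$ of the (locally defined, up to sign) Gauss map $g$ of $S$ with values in $S^2$ is an immersion. Regard $\mathbf{R}^3$ as a subset of $\mathbf{R}P^3$ by $x\mapsto[1:x]$, let $I=\{([X],[Y])\in\mathbf{R}P^3\times\mathbf{R}P^{3*}\mid Y(X)=0\}$ be the incidence manifold, and let $\pi_1:I\to\mathbf{R}P^3$ and $\pi_2:I\to\mathbf{R}P^{3*}$ be the projections. The Legendre lift of a surface $M\subset\mathbf{R}^3$ (with or without boundary) is the set of all $([X],[Y])\in I$ such that $[X]\in M$ and the projective plane $\ker Y$ is the projective closure of the affine tangent plane of $M$ at $[X]$. Let $\Gamma$ be the part of the Legendre lift of $S$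 that lies over $\gamma$, and let $\widehat\gamma=\pi_2(\Gamma)\subset\mathbf{R}P^{3*}$ be the dual-boundary. Then every $p\in\gamma$ has an open neighbourhood $U$ in $S'=\widetilde S\setminus\mathrm{Int}\,S$ whose Legendre lift $L_U$ projects by $\pi_2$ into the dual-boundary, $\pi_2(L_U)\subset\widehat\gamma$; more precisely, $U$ can be chosen so that $\pi_2$ maps $L_U$ onto the part of $\widehat\gamma$ over $U\cap\gamma$, i.e. $\pi_2(L_U)=\pi_2(\Gamma\cap\pi_1^{-1}(U))$. -/

import Mathlib

open scoped ContDiff LinearAlgebra.Projectivization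

noncomputable section

namespace FlatExtension

/-- Euclidean `3`-space. -/
abbrev E3 : Type := EuclideanSpace ℝ (Fin 3)

/-! ### Surfaces in Euclidean space -/

/-- `Φ` is a local diffeomorphism of class `C^n` between open subsets of `ℝ³`. -/
def IsDiffeoOn (n : WithTop ℕ∞) (Φ : OpenPartialHomeomorph E3 E3) : Prop :=
  ContDiffOn ℝ n Φ Φ.source ∧ ContDiffOn ℝ n Φ.symm Φ.target

/-- `Φ` straightens `M` to the coordinate plane `{y₂ = 0}`. -/
def IsPlaneChart (n : WithTop ℕ∞) (M : Set E3) (Φ : OpenPartialHomeomorph E3 E3) : Prop :=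
  IsDiffeoOn n Φ ∧ ∀ x ∈ Φ.source, x ∈ M ↔ Φ x 2 = 0

/-- `Φ` straightens `M` to the coordinate half-plane `{y₂ = 0, y₁ ≥ 0}`. -/
def IsHalfPlaneChart (n : WithTop ℕ∞) (M : Set E3) (Φ : OpenPartialHomeomorph E3 E3) : Prop :=
  IsDiffeoOn n Φ ∧ ∀ x ∈ Φ.source, x ∈ M ↔ (Φ x 2 = 0 ∧ 0 ≤ Φ x 1)

/-- `M` is an (embedded) surface of class `C^n` without boundary in `ℝ³`. -/
def IsSurface (n : WithTop ℕ∞) (M : Set E3) : Prop :=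
  ∀ p ∈ M, ∃ Φ : OpenPartialHomeomorph E3 E3, p ∈ Φ.source ∧ IsPlaneChart n M Φ

/-- `M` is an (embedded) `C^∞` surface with boundary in `ℝ³`. The boundary may be empty:
an interior point is one that a half-plane chart sends into the open half-plane `{y₁ > 0}`. -/
def IsSurfaceWithBoundary (M : Set E3) : Prop :=
  ∀ p ∈ M, ∃ Φ : OpenPartialHomeomorph E3 E3, p ∈ Φ.source ∧ IsHalfPlaneChart ∞ M Φ

/-- The boundary of a `C^∞` surface with boundary. -/
def boundary (M : Set E3) : Set E3 :=
  {p | p ∈ M ∧ ∃ Φ : OpenPartialHomeomorph E3 E3,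
    p ∈ Φ.source ∧ IsHalfPlaneChart ∞ M Φ ∧ Φ p 1 = 0}

/-- The interior `Int M` of a `C^∞` surface with boundary. -/
def surfaceInterior (M : Set E3) : Set E3 := M \ boundary M

/-- The tangent space of `M` at `x` as a linear subspace of `ℝ³`. At a boundary point of a
surface with boundary it is the full tangent plane; for a curve it is the tangent line. -/
def tangentSpace (M : Set E3) (x : E3) : Submodule ℝ E3 :=
  Submodule.span ℝ (tangentConeAt ℝ M x)

/-! ### Gauss map and Gaussian curvature -/

/-- On the open set `W`, the map `N` is (a `C^∞` extension to `W` of) a choice of the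
Gauss map `M ∩ W → S²`, i.e. of a unit normal field of `M`. -/
def IsGaussMapOn (M W : Set E3) (N : E3 → E3) : Prop :=
  ContDiffOn ℝ ∞ N W ∧
    ∀ x ∈ M ∩ W, ‖N x‖ = 1 ∧ ∀ v ∈ tangentSpace M x, inner ℝ (N x) v = 0

/-- The differential at `x` of the Gauss map `N` of `M`, as an endomorphism of `T_x M`
(the negative of the shape operator). Only the restriction of `N` to `M` matters, and for a unit
normal field the derivative maps `T_x M` to itself, so the projection changes nothing. -/
def gaussDifferential (M : Set E3) (N : E3 → E3) (x : E3) :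
    tangentSpace M x →ₗ[ℝ] tangentSpace M x :=
  ((tangentSpace M x).orthogonalProjectionOnto ∘L
    (fderiv ℝ N x ∘L (tangentSpace M x).subtypeL)).toLinearMap

/-- The Gaussian curvature at `x` of a surface `M` with Gauss map `N` near `x`. It does
not change if `N` is replaced by `-N`. -/
def gaussianCurvature (M : Set E3) (N : E3 → E3) (x : E3) : ℝ :=
  LinearMap.det (gaussDifferential M N x)

/-- The Gaussian curvature of `M` vanishes identically. -/
def IsFlat (M : Set E3) : Prop :=
  ∀ p ∈ M, ∃ (W : Set E3) (N : E3 → E3), IsOpen W ∧ p ∈ W ∧ IsGaussMapOn M W N ∧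
    ∀ x ∈ M ∩ W, gaussianCurvature M N x = 0

/-- The Gauss map of `M`, restricted to the curve `c ⊆ M`, is an immersion. -/
def GaussMapImmersiveAlong (M c : Set E3) : Prop :=
  ∀ p ∈ c, ∃ (W : Set E3) (N : E3 → E3), IsOpen W ∧ p ∈ W ∧ IsGaussMapOn M W N ∧
    ∀ v ∈ tangentSpace c p, v ≠ 0 → fderiv ℝ N p v ≠ 0

/-- `T` is a flat `C¹` extension of the surface with boundary `S`. -/
structure IsFlatC1Extension (S T : Set E3) : Prop where
  surface : IsSurface 1 T
  subset : S ⊆ T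
  smooth : IsSurfaceWithBoundary (T \ surfaceInterior S)
  flat : IsFlat (T \ surfaceInterior S)

/-! ### Projective duality -/

/-- The projective space `ℝP³`, in homogeneous coordinates `[X₀ : X]` with `X₀ ∈ ℝ`, `X ∈ ℝ³`. -/
abbrev RP3 : Type := ℙ ℝ (ℝ × E3)

/-- The dual projective space `ℝP³*`. -/
abbrev RP3Dual : Type := ℙ ℝ (Module.Dual ℝ (ℝ × E3))

/-- The incidence manifold `I⁵ = {([X], [Y]) | Y(X) = 0}`. -/
abbrev Incidence : Type := {z : RP3 × RP3Dual // z.2.rep z.1.rep = 0}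

/-- The projection `I⁵ → ℝP³`. -/
def proj₁ (z : Incidence) : RP3 := z.1.1

/-- The projection `I⁵ → ℝP³*`. -/
def proj₂ (z : Incidence) : RP3Dual := z.1.2

/-- The standard embedding `ℝ³ → ℝP³`, `x ↦ [1 : x]`. -/
def affinePoint (x : E3) : RP3 :=
  Projectivization.mk ℝ ((1 : ℝ), x) (fun h => one_ne_zero (congrArg Prod.fst h))

/-- The linear subspace of `ℝ × ℝ³` whose projectivization is the projective closure of the
affine tangent plane `x + T_x M`. -/
def projectiveTangentSpace (M : Set E3) (x : E3) : Submodule ℝ (ℝ × E3) :=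
  Submodule.span ℝ {((1 : ℝ), x)} ⊔ (tangentSpace M x).map (LinearMap.inr ℝ ℝ E3)

/-- The Legendre lift of `M`: the pairs of a point of `M` and the projective tangent plane there. -/
def legendreLift (M : Set E3) : Set Incidence :=
  {z | ∃ x ∈ M, proj₁ z = affinePoint x ∧
    LinearMap.ker (proj₂ z).rep = projectiveTangentSpace M x}

/-- The boundary `Γ` of the Legendre lift `L` of a surface with boundary. -/
def boundaryLift (M : Set E3) : Set Incidence :=
  {z | z ∈ legendreLift M ∧ proj₁ z ∈ affinePoint '' boundary M}

/-- The dual-boundary: the image of `Γ` in the dual projective space. -/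
def dualBoundary (M : Set E3) : Set RP3Dual := proj₂ '' boundaryLift M

end FlatExtension

end

open scoped ContDiff LinearAlgebra.Projectivization

open Set Filter Topology

noncomputable section

namespace FlatExtension

/-! ### Local diffeomorphisms and charts -/

/-! Write M = T \ Int S and let N be a unit normal of M near p ∈ ∂S. Since T is C¹, the tangent
planes of S, M and T agree on ∂S (`IsSurfaceWithBoundary.tangentSpace_eq`), so N equals the Gauss
map of S up to sign there and is immersive along ∂S (`fderiv_ne_zero_of_immersive`). Flatness gives
dN a kernel in every tangent plane of M, so dN has rank one near p and its kernel is transverse to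
∂S.

To exploit this, replace the first coordinate of a boundary chart by y₀ = ⟨w, N⟩, where w is the
derivative of N along ∂S at p (`exists_adapted_chart`). A kernel vector of dN kills y₀, hence points
along y₁. So N is constant on each line y₀ = const in M, and ⟨N, ·⟩ is constant on it as well
because the line is tangent to M: the whole affine tangent plane is constant
(`normal_eq_along_line`). Following the line back to y₁ = 0 reaches a boundary point with the same
tangent plane (`exists_neighborhood_tangent_eq`). It is never needed that these lines are straight
in ℝ³.

The remaining point is that the boundary of M is ∂S near p. Both inclusions,
`mem_boundary_of_coord_eq_zero` and `coord_eq_zero_of_mem_boundary`, compare one-sided with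
two-sided curves: at a boundary point, only directions tangent to the boundary are velocities of
curves that stay in the surface for times of both signs. -/

theorem IsDiffeoOn.of_le {m n : WithTop ℕ∞} {Φ : OpenPartialHomeomorph E3 E3}
    (h : IsDiffeoOn n Φ) (hmn : m ≤ n) : IsDiffeoOn m Φ :=
  ⟨h.1.of_le hmn, h.2.of_le hmn⟩

theorem IsHalfPlaneChart.of_le {m n : WithTop ℕ∞} {M : Set E3}
    {Φ : OpenPartialHomeomorph E3 E3} (h : IsHalfPlaneChart n M Φ) (hmn : m ≤ n) :
    IsHalfPlaneChart m M Φ :=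
  ⟨h.1.of_le hmn, h.2⟩

/-- The derivative of a local diffeomorphism as a linear equivalence. -/
theorem IsDiffeoOn.exists_hasFDerivAt {Φ : OpenPartialHomeomorph E3 E3} (h : IsDiffeoOn 1 Φ)
    {x : E3} (hx : x ∈ Φ.source) :
    ∃ L : E3 ≃L[ℝ] E3, HasFDerivAt Φ (L : E3 →L[ℝ] E3) x ∧
      HasFDerivAt Φ.symm (L.symm : E3 →L[ℝ] E3) (Φ x) := by
  have h1 : HasFDerivAt Φ (fderiv ℝ Φ x) x :=
    ((h.1.contDiffAt (Φ.open_source.mem_nhds hx)).differentiableAt one_ne_zero).hasFDerivAt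
  have h2 : HasFDerivAt Φ.symm (fderiv ℝ Φ.symm (Φ x)) (Φ x) :=
    ((h.2.contDiffAt (Φ.open_target.mem_nhds (Φ.map_source hx))).differentiableAt
      one_ne_zero).hasFDerivAt
  have e1 : (fderiv ℝ Φ.symm (Φ x)) ∘L (fderiv ℝ Φ x) = ContinuousLinearMap.id ℝ E3 := by
    refine (h2.comp x h1).unique ((hasFDerivAt_id x).congr_of_eventuallyEq ?_)
    filter_upwards [Φ.open_source.mem_nhds hx] with y hy using Φ.left_inv hy
  have e2 : (fderiv ℝ Φ x) ∘L (fderiv ℝ Φ.symm (Φ x)) = ContinuousLinearMap.id ℝ E3 := by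
    have h1' : HasFDerivAt Φ (fderiv ℝ Φ x) (Φ.symm (Φ x)) := by rwa [Φ.left_inv hx]
    refine (h1'.comp (Φ x) h2).unique ((hasFDerivAt_id _).congr_of_eventuallyEq ?_)
    filter_upwards [Φ.open_target.mem_nhds (Φ.map_source hx)] with y hy using Φ.right_inv hy
  exact ⟨ContinuousLinearEquiv.equivOfInverse _ _ (fun v => DFunLike.congr_fun e1 v)
    (fun v => DFunLike.congr_fun e2 v), h1, h2⟩

/-- The inverse function theorem, with a prescribed neighbourhood containing the source. -/
theorem exists_isDiffeoOn {F : E3 → E3} {p : E3} {s : Set E3} (hs : s ∈ 𝓝 p)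
    (hF : ContDiffAt ℝ 1 F p) (hinj : ∀ v, fderiv ℝ F p v = 0 → v = 0) :
    ∃ Θ : OpenPartialHomeomorph E3 E3, (Θ : E3 → E3) = F ∧ p ∈ Θ.source ∧ Θ.source ⊆ s ∧
      IsDiffeoOn 1 Θ := by
  have hinj' : Function.Injective (fderiv ℝ F p : E3 →ₗ[ℝ] E3) :=
    (injective_iff_map_eq_zero _).2 hinj
  let L : E3 ≃L[ℝ] E3 :=
    (LinearEquiv.ofInjectiveEndo (fderiv ℝ F p : E3 →ₗ[ℝ] E3) hinj').toContinuousLinearEquiv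
  have hL : HasFDerivAt F (L : E3 →L[ℝ] E3) p := by
    have : (L : E3 →L[ℝ] E3) = fderiv ℝ F p := ContinuousLinearMap.ext fun _ => rfl
    rw [this]
    exact (hF.differentiableAt one_ne_zero).hasFDerivAt
  let Θ := hF.toOpenPartialHomeomorph F hL one_ne_zero
  have hΘ : (Θ : E3 → E3) = F := hF.toOpenPartialHomeomorph_coe hL one_ne_zero
  have hp : p ∈ Θ.source := hF.mem_toOpenPartialHomeomorph_source hL one_ne_zero
  have hsymm : ContDiffAt ℝ 1 Θ.symm (Θ p) := by
    refine Θ.contDiffAt_symm (f₀' := L) (Θ.map_source hp) ?_ ?_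
    · rw [Θ.left_inv hp, hΘ]; exact hL
    · rw [Θ.left_inv hp, hΘ]; exact hF
  have ev1 : ∀ᶠ y in 𝓝 p, ContDiffAt ℝ 1 F y := hF.eventually (by simp)
  have ev2 : ∀ᶠ y in 𝓝 p, ContDiffAt ℝ 1 Θ.symm (Θ y) :=
    (Θ.continuousAt hp).eventually (hsymm.eventually (by simp))
  obtain ⟨V, hV, hVo, hpV⟩ := _root_.mem_nhds_iff.1 (inter_mem hs (ev1.and ev2))
  refine ⟨Θ.restrOpen V hVo, hΘ, ⟨hp, hpV⟩, fun y hy => (hV hy.2).1, ?_, ?_⟩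
  · intro y hy
    have := (hV hy.2).2.1
    rw [← hΘ] at this
    exact this.contDiffWithinAt
  · intro y hy
    have hy' := (Θ.restrOpen V hVo).map_target hy
    have h1 := (hV hy'.2).2.2
    have h2 : Θ (((Θ.restrOpen V hVo).symm) y) = y := (Θ.restrOpen V hVo).right_inv hy
    rw [h2] at h1
    exact h1.contDiffWithinAt

/-- The curve whose image under `Φ` is the line through `Φ x` in direction `w`. -/
theorem chartCurve_properties {Φ : OpenPartialHomeomorph E3 E3} {x : E3} (hx : x ∈ Φ.source)
    {L : E3 ≃L[ℝ] E3} (hL : HasFDerivAt Φ.symm (L.symm : E3 →L[ℝ] E3) (Φ x)) (w : E3) :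
    HasDerivAt (fun t : ℝ => Φ.symm (Φ x + t • w)) (L.symm w) 0 ∧
      Φ.symm (Φ x + (0 : ℝ) • w) = x ∧
      ∀ᶠ t : ℝ in 𝓝 0, Φ.symm (Φ x + t • w) ∈ Φ.source ∧
        Φ (Φ.symm (Φ x + t • w)) = Φ x + t • w := by
  have hl : HasDerivAt (fun t : ℝ => Φ x + t • w) w 0 := by
    simpa using ((hasDerivAt_id (0 : ℝ)).smul_const w).const_add (Φ x)
  refine ⟨?_, by simp [Φ.left_inv hx], ?_⟩
  · have hL' : HasFDerivAt Φ.symm (L.symm : E3 →L[ℝ] E3) (Φ x + (0 : ℝ) • w) := by simpa using hL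
    exact hL'.comp_hasDerivAt (0 : ℝ) hl
  · have : ∀ᶠ t : ℝ in 𝓝 0, Φ x + t • w ∈ Φ.target :=
      hl.continuousAt.eventually_mem (Φ.open_target.mem_nhds (by simpa using Φ.map_source hx))
    filter_upwards [this] with t ht using ⟨Φ.map_target ht, Φ.right_inv ht⟩

/-! ### Tangent spaces -/

theorem tangentSpace_mono {M M' : Set E3} (h : M ⊆ M') (x : E3) :
    tangentSpace M x ≤ tangentSpace M' x :=
  Submodule.span_mono (tangentConeAt_mono h)

theorem tangentSpace_inter_open {M W : Set E3} (hW : IsOpen W) {x : E3} (hx : x ∈ W) :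
    tangentSpace (W ∩ M) x = tangentSpace M x := by
  rw [tangentSpace, inter_comm, tangentConeAt_inter_nhds (hW.mem_nhds hx), tangentSpace]

/-- One-sided curves suffice: the set of times accumulates at 0, so its tangent cone is all of ℝ,
and derivatives map tangent cones to tangent cones. -/
theorem mem_tangentSpace_of_curve {M : Set E3} {c : ℝ → E3} {v : E3} (hc : HasDerivAt c v 0)
    (hM : ∀ᶠ t in 𝓝[>] 0, c t ∈ M) : v ∈ tangentSpace M (c 0) := by
  refine Submodule.subset_span ?_
  let s : Set ℝ := {t | 0 < t ∧ c t ∈ M}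
  have hs : s ∈ 𝓝[>] (0 : ℝ) := by
    filter_upwards [hM, self_mem_nhdsWithin] with t h1 h2 using ⟨h2, h1⟩
  have hacc : AccPt (0 : ℝ) (𝓟 s) := by
    rw [accPt_iff_frequently]
    have h1 : ∃ᶠ t in 𝓝[>] (0 : ℝ), t ≠ 0 ∧ t ∈ s := by
      refine Eventually.frequently ?_
      filter_upwards [hs] with t ht using ⟨ht.1.ne', ht⟩
    exact h1.filter_mono nhdsWithin_le_nhds
  have h1 : (1 : ℝ) ∈ tangentConeAt ℝ s 0 := by rw [tangentConeAt_eq_univ hacc]; trivial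
  have h2 := hc.hasFDerivAt.hasFDerivWithinAt (s := s) |>.mapsTo_tangent_cone h1
  have h3 : c '' s ⊆ M := by rintro _ ⟨t, ht, rfl⟩; exact ht.2
  simpa using tangentConeAt_mono h3 h2

/-- A function that is constant on `M` near `x` has derivative zero along `M`. -/
theorem fderiv_eq_zero_of_mem_tangentSpace {G : Type*} [NormedAddCommGroup G] [NormedSpace ℝ G]
    {M : Set E3} {x : E3} {f : E3 → G} {f' : E3 →L[ℝ] G} {a : G} (hf : HasFDerivAt f f' x)
    (hx : f x = a) (h : ∀ᶠ y in 𝓝 x, y ∈ M → f y = a) {v : E3} (hv : v ∈ tangentSpace M x) :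
    f' v = 0 := by
  have h0 : HasFDerivWithinAt f (0 : E3 →L[ℝ] G) M x := by
    refine (hasFDerivWithinAt_const a x M).congr_of_eventuallyEq ?_ hx
    rw [EventuallyEq, eventually_nhdsWithin_iff]
    exact h
  have h1 : Set.EqOn f' (0 : E3 →L[ℝ] G) (tangentConeAt ℝ M x) :=
    hf.hasFDerivWithinAt.unique_on h0
  have h2 : tangentSpace M x ≤ LinearMap.ker (f' : E3 →ₗ[ℝ] G) :=
    Submodule.span_le.2 fun w hw => h1 hw
  exact h2 hv

theorem hasFDerivAt_coord {F : E3 → E3} {F' : E3 →L[ℝ] E3} {x : E3} (h : HasFDerivAt F F' x)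
    (i : Fin 3) : HasFDerivAt (fun y => F y i) (EuclideanSpace.proj i ∘L F') x :=
  (EuclideanSpace.proj (𝕜 := ℝ) i).hasFDerivAt.comp x h

/-- The tangent space in a chart that straightens `M` to a set between a half-plane based at `x`
and the plane. -/
theorem mem_tangentSpace_iff {M : Set E3} {Φ : OpenPartialHomeomorph E3 E3} {x : E3}
    (hx : x ∈ Φ.source) (hxM : x ∈ M) (h1 : ∀ y ∈ Φ.source, y ∈ M → Φ y 2 = 0)
    (h2 : ∀ y ∈ Φ.source, Φ y 2 = 0 → Φ x 1 ≤ Φ y 1 → y ∈ M)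
    {L : E3 ≃L[ℝ] E3} (hL : HasFDerivAt Φ (L : E3 →L[ℝ] E3) x)
    (hL' : HasFDerivAt Φ.symm (L.symm : E3 →L[ℝ] E3) (Φ x)) (v : E3) :
    v ∈ tangentSpace M x ↔ L v 2 = 0 := by
  constructor
  · intro hv
    refine fderiv_eq_zero_of_mem_tangentSpace (hasFDerivAt_coord hL 2) (h1 x hx hxM) ?_ hv
    filter_upwards [Φ.open_source.mem_nhds hx] with y hy using h1 y hy
  -- Directions into the half-plane are velocities of curves in M; the opposite ones follow because
  -- the tangent space is a span.
  · have key : ∀ w : E3, w 2 = 0 → 0 ≤ w 1 → L.symm w ∈ tangentSpace M x := by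
      intro w hw2 hw1
      obtain ⟨hc, hc0, hev⟩ := chartCurve_properties hx hL' w
      have := mem_tangentSpace_of_curve (M := M) hc ?_
      · simpa only [hc0] using this
      filter_upwards [nhdsWithin_le_nhds hev, self_mem_nhdsWithin] with t ht ht0
      have ht0 : 0 < t := ht0
      refine h2 _ ht.1 ?_ ?_
      · rw [ht.2]; simp [hw2, h1 x hx hxM]
      · rw [ht.2]; simp only [PiLp.add_apply, PiLp.smul_apply, smul_eq_mul]
        nlinarith
    intro hv
    rcases le_total 0 (L v 1) with h | h
    · simpa using key (L v) hv h
    · have := key (-L v) (by simp [hv]) (by simpa using h)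
      simpa using this

theorem IsHalfPlaneChart.mem_tangentSpace_iff {M : Set E3} {Φ : OpenPartialHomeomorph E3 E3}
    (h : IsHalfPlaneChart 1 M Φ) {x : E3} (hx : x ∈ Φ.source) (hxM : x ∈ M)
    {L : E3 ≃L[ℝ] E3} (hL : HasFDerivAt Φ (L : E3 →L[ℝ] E3) x)
    (hL' : HasFDerivAt Φ.symm (L.symm : E3 →L[ℝ] E3) (Φ x)) (v : E3) :
    v ∈ tangentSpace M x ↔ L v 2 = 0 :=
  FlatExtension.mem_tangentSpace_iff hx hxM (fun y hy hyM => ((h.2 y hy).1 hyM).1)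
    (fun y hy h2 h1 => (h.2 y hy).2 ⟨h2, ((h.2 x hx).1 hxM).2.trans h1⟩) hL hL' v

theorem IsPlaneChart.mem_tangentSpace_iff {M : Set E3} {Φ : OpenPartialHomeomorph E3 E3}
    (h : IsPlaneChart 1 M Φ) {x : E3} (hx : x ∈ Φ.source) (hxM : x ∈ M)
    {L : E3 ≃L[ℝ] E3} (hL : HasFDerivAt Φ (L : E3 →L[ℝ] E3) x)
    (hL' : HasFDerivAt Φ.symm (L.symm : E3 →L[ℝ] E3) (Φ x)) (v : E3) :
    v ∈ tangentSpace M x ↔ L v 2 = 0 :=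
  FlatExtension.mem_tangentSpace_iff hx hxM (fun y hy hyM => (h.2 y hy).1 hyM)
    (fun y hy h2 _ => (h.2 y hy).2 h2) hL hL' v

theorem finrank_eq_two_of_mem_iff {V : Submodule ℝ E3} (L : E3 ≃L[ℝ] E3)
    (h : ∀ v, v ∈ V ↔ L v 2 = 0) : Module.finrank ℝ V = 2 := by
  let f : Module.Dual ℝ E3 :=
    ((EuclideanSpace.proj (2 : Fin 3) : E3 →L[ℝ] ℝ) ∘L (L : E3 →L[ℝ] E3)).toLinearMap
  have hf : f ≠ 0 := by
    intro h0
    have := LinearMap.congr_fun h0 (L.symm (EuclideanSpace.single 2 1))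
    simp [f] at this
  have hV : V = LinearMap.ker f := by ext v; exact h v
  have := Module.Dual.finrank_ker_add_one_of_ne_zero hf
  rw [hV]
  simp only [finrank_euclideanSpace, Fintype.card_fin] at this
  omega

theorem IsSurfaceWithBoundary.finrank_tangentSpace {M : Set E3} (h : IsSurfaceWithBoundary M)
    {x : E3} (hx : x ∈ M) : Module.finrank ℝ (tangentSpace M x) = 2 := by
  obtain ⟨Φ, hxΦ, hΦ⟩ := h x hx
  have hΦ := hΦ.of_le (m := 1) (by simp)
  obtain ⟨L, hL, hL'⟩ := hΦ.1.exists_hasFDerivAt hxΦ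
  exact finrank_eq_two_of_mem_iff L (hΦ.mem_tangentSpace_iff hxΦ hx hL hL')

theorem IsSurface.finrank_tangentSpace {M : Set E3} (h : IsSurface 1 M)
    {x : E3} (hx : x ∈ M) : Module.finrank ℝ (tangentSpace M x) = 2 := by
  obtain ⟨Φ, hxΦ, hΦ⟩ := h x hx
  obtain ⟨L, hL, hL'⟩ := hΦ.1.exists_hasFDerivAt hxΦ
  exact finrank_eq_two_of_mem_iff L (hΦ.mem_tangentSpace_iff hxΦ hx hL hL')

/-- Nested planes of equal dimension. Applied to both S and T \ Int S, this identifies their tangent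
planes along ∂S. -/
theorem IsSurfaceWithBoundary.tangentSpace_eq {M T : Set E3} (hM : IsSurfaceWithBoundary M)
    (hT : IsSurface 1 T) (h : M ⊆ T) {x : E3} (hx : x ∈ M) :
    tangentSpace M x = tangentSpace T x :=
  Submodule.eq_of_le_of_finrank_eq (tangentSpace_mono h x)
    ((hM.finrank_tangentSpace hx).trans (hT.finrank_tangentSpace (h hx)).symm)

theorem mem_iff_inner_eq_zero {V : Submodule ℝ E3} (hV : Module.finrank ℝ V = 2) {n : E3}
    (hn : ‖n‖ = 1) (h : ∀ v ∈ V, inner ℝ n v = 0) (v : E3) : v ∈ V ↔ inner ℝ n v = 0 := by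
  have hn0 : n ≠ 0 := by rintro rfl; simp at hn
  have : Fact (Module.finrank ℝ E3 = 2 + 1) := ⟨by simp⟩
  have hle : V ≤ (Submodule.span ℝ {n})ᗮ := fun w hw =>
    Submodule.mem_orthogonal_singleton_iff_inner_right.2 (h w hw)
  have := Submodule.eq_of_le_of_finrank_eq hle
    (hV.trans (Submodule.finrank_orthogonal_span_singleton (n := 2) hn0).symm)
  rw [this, Submodule.mem_orthogonal_singleton_iff_inner_right]

/-! ### Boundary points -/

/-- A two-sided curve in `M` through a boundary point is tangent to the boundary. -/
theorem coord_eq_zero_of_curve {M : Set E3} {Φ : OpenPartialHomeomorph E3 E3}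
    (hΦ : IsHalfPlaneChart 1 M Φ) {c : ℝ → E3} {v : E3} (hc : HasDerivAt c v 0)
    (hM : ∀ᶠ t in 𝓝 0, c t ∈ M) (hx : c 0 ∈ Φ.source) (h1 : Φ (c 0) 1 = 0)
    {L : E3 →L[ℝ] E3} (hL : HasFDerivAt Φ L (c 0)) : L v 1 = 0 := by
  have hd : HasDerivAt (fun t => Φ (c t) 1) (L v 1) 0 :=
    (hasFDerivAt_coord hL 1).comp_hasDerivAt (0 : ℝ) hc
  refine IsLocalMin.hasDerivAt_eq_zero ?_ hd
  have hs : ∀ᶠ t in 𝓝 0, c t ∈ Φ.source :=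
    hc.continuousAt.eventually_mem (Φ.open_source.mem_nhds hx)
  filter_upwards [hM, hs] with t ht hts
  rw [h1]
  exact ((hΦ.2 _ hts).1 ht).2

/-- If all tangent directions at `x` are velocities of two-sided curves in `M`,
then `x` is not on the boundary in any chart. -/
theorem coord_ne_zero_of_curves {M : Set E3} {Φ : OpenPartialHomeomorph E3 E3}
    (hΦ : IsHalfPlaneChart 1 M Φ) {x : E3} (hx : x ∈ Φ.source) (hxM : x ∈ M)
    (h : ∀ v ∈ tangentSpace M x, ∃ c : ℝ → E3, c 0 = x ∧ HasDerivAt c v 0 ∧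
      ∀ᶠ t in 𝓝 0, c t ∈ M) : Φ x 1 ≠ 0 := by
  intro h1
  obtain ⟨L, hL, hL'⟩ := hΦ.1.exists_hasFDerivAt hx
  -- The inward direction: a two-sided curve with this velocity would give the second coordinate a
  -- local minimum with derivative 1.
  have hv : L.symm (EuclideanSpace.single 1 1) ∈ tangentSpace M x :=
    (hΦ.mem_tangentSpace_iff hx hxM hL hL' _).2 (by simp)
  obtain ⟨c, rfl, hc, hcM⟩ := h _ hv
  have := coord_eq_zero_of_curve hΦ hc hcM hx h1 hL
  simp at this

/-- Independence of the chart: from a point of the open half-plane the chart lines stay in M on both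
sides, which `coord_ne_zero_of_curves` excludes at a boundary point. -/
theorem notMem_boundary_of_coord_pos {M : Set E3} {Φ : OpenPartialHomeomorph E3 E3}
    (hΦ : IsHalfPlaneChart 1 M Φ) {x : E3} (hx : x ∈ Φ.source) (hxM : x ∈ M)
    (h : 0 < Φ x 1) : x ∉ boundary M := by
  rintro ⟨-, Φ', hx', hΦ', h0⟩
  refine coord_ne_zero_of_curves (hΦ'.of_le (by simp)) hx' hxM (fun v hv => ?_) h0
  obtain ⟨L, hL, hL'⟩ := hΦ.1.exists_hasFDerivAt hx
  have hv2 := (hΦ.mem_tangentSpace_iff hx hxM hL hL' v).1 hv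
  obtain ⟨hc, hc0, hev⟩ := chartCurve_properties hx hL' (L v)
  refine ⟨_, hc0, by simpa using hc, ?_⟩
  have hpos : ∀ᶠ t : ℝ in 𝓝 0, 0 < Φ x 1 + t * L v 1 := by
    have : ContinuousAt (fun t : ℝ => Φ x 1 + t * L v 1) 0 := by fun_prop
    exact this.eventually_const_lt (by simpa using h)
  filter_upwards [hev, hpos] with t ht htpos
  refine (hΦ.2 _ ht.1).2 ?_
  rw [ht.2]
  refine ⟨?_, ?_⟩
  · simp [hv2, ((hΦ.2 x hx).1 hxM).1]
  · simpa using htpos.le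

/-- Three functions with independent differentials form a local coordinate system. -/
theorem exists_isDiffeoOn_coords {f : Fin 3 → E3 → ℝ} {f' : Fin 3 → E3 →L[ℝ] ℝ} {p : E3}
    {s : Set E3} (hs : s ∈ 𝓝 p) (hf : ∀ i, ContDiffAt ℝ 1 (f i) p)
    (hf' : ∀ i, HasFDerivAt (f i) (f' i) p) (hinj : ∀ v, (∀ i, f' i v = 0) → v = 0) :
    ∃ Θ : OpenPartialHomeomorph E3 E3, (∀ x i, Θ x i = f i x) ∧ p ∈ Θ.source ∧ Θ.source ⊆ s ∧
      IsDiffeoOn 1 Θ := by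
  have hF : ContDiffAt ℝ 1 (fun x => (WithLp.toLp 2 fun i => f i x : E3)) p :=
    contDiffAt_euclidean.2 hf
  obtain ⟨Θ, hΘ, hp, hsub, hd⟩ := exists_isDiffeoOn hs hF fun v hv => hinj v fun i => by
    have h := hasFDerivAt_coord (hF.differentiableAt one_ne_zero).hasFDerivAt i
    rw [(hf' i).unique h]
    simp [hv]
  exact ⟨Θ, fun x i => by rw [hΘ], hp, hsub, hd⟩

/-! ### The boundary of the complementary surface -/

/-- Near a boundary point of `S`, boundary points of `T \ Int S` belong to the boundary of `S`. -/
theorem mem_boundary_of_coord_eq_zero {S T : Set E3} (hT : IsSurface 1 T)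
    {Φ Φs : OpenPartialHomeomorph E3 E3} (hΦ : IsHalfPlaneChart 1 (T \ surfaceInterior S) Φ)
    {n : WithTop ℕ∞} (hΦs : IsHalfPlaneChart n S Φs) {x : E3} (hx : x ∈ Φ.source)
    (hxs : x ∈ Φs.source) (hxM : x ∈ T \ surfaceInterior S) (h1 : Φ x 1 = 0) :
    x ∈ boundary S := by
  by_contra hxb
  have hxS : x ∉ S := fun h => hxM.2 ⟨h, hxb⟩
  -- S is relatively closed in the domain of its chart, so near x the surface T avoids S and lies
  -- entirely in T \ Int S.
  have hev : ∀ᶠ y in 𝓝 x, y ∉ S := by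
    have hcl : IsClosed {z : E3 | z 2 = 0 ∧ 0 ≤ z 1} :=
      (isClosed_eq (f := fun z : E3 => z 2) (by fun_prop) continuous_const).inter
        (isClosed_le (g := fun z : E3 => z 1) continuous_const (by fun_prop))
    have hz : Φs x ∉ {z : E3 | z 2 = 0 ∧ 0 ≤ z 1} := fun h => hxS ((hΦs.2 x hxs).2 h)
    filter_upwards [(Φs.continuousAt hxs).eventually_mem (hcl.isOpen_compl.mem_nhds hz),
      Φs.open_source.mem_nhds hxs] with y hy hys hyS
    exact hy ((hΦs.2 y hys).1 hyS)
  refine coord_ne_zero_of_curves hΦ hx hxM (fun v hv => ?_) h1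
  obtain ⟨Ψ, hxΨ, hΨ⟩ := hT x hxM.1
  obtain ⟨L, hL, hL'⟩ := hΨ.1.exists_hasFDerivAt hxΨ
  have hv2 := (hΨ.mem_tangentSpace_iff hxΨ hxM.1 hL hL' v).1 (tangentSpace_mono sdiff_subset x hv)
  obtain ⟨hc, hc0, hcev⟩ := chartCurve_properties hxΨ hL' (L v)
  refine ⟨_, hc0, by simpa using hc, ?_⟩
  have hevc : ∀ᶠ t : ℝ in 𝓝 0, Ψ.symm (Ψ x + t • L v) ∉ S :=
    hc.continuousAt.eventually (by simpa only [hc0] using hev)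
  filter_upwards [hcev, hevc] with t ht hts
  refine ⟨(hΨ.2 _ ht.1).2 ?_, fun h => hts h.1⟩
  rw [ht.2]
  simp [hv2, (hΨ.2 x hxΨ).1 hxM.1]

/-- A surface with boundary contained in a surface `T` is a neighbourhood in `T` of each point
that is interior in some chart. -/
theorem eventually_mem_of_coord_pos {M T : Set E3} (hT : IsSurface 1 T) (hMT : M ⊆ T)
    (hM : IsSurfaceWithBoundary M) {Φ : OpenPartialHomeomorph E3 E3}
    (hΦ : IsHalfPlaneChart 1 M Φ) {p : E3} (hp : p ∈ Φ.source) (hpM : p ∈ M)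
    (h1 : 0 < Φ p 1) : ∀ᶠ x in 𝓝 p, x ∈ T → x ∈ M := by
  obtain ⟨Ψ, hpΨ, hΨ⟩ := hT p (hMT hpM)
  obtain ⟨L, hL, hL'⟩ := hΦ.1.exists_hasFDerivAt hp
  obtain ⟨K, hK, hK'⟩ := hΨ.1.exists_hasFDerivAt hpΨ
  have cΦ : ∀ i, ContDiffAt ℝ 1 (fun x => Φ x i) p := fun i =>
    contDiffAt_euclidean.1 (hΦ.1.1.contDiffAt (Φ.open_source.mem_nhds hp)) i
  have cΨ : ∀ i, ContDiffAt ℝ 1 (fun x => Ψ x i) p := fun i =>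
    contDiffAt_euclidean.1 (hΨ.1.1.contDiffAt (Ψ.open_source.mem_nhds hpΨ)) i
  -- Mixed coordinates: along M by Φ, transversally by the function defining T. They are independent
  -- because M and T share their tangent plane at p.
  obtain ⟨Θ, hΘ, hpΘ, hsub, -⟩ := exists_isDiffeoOn_coords
    (f := ![fun x => Φ x 0, fun x => Φ x 1, fun x => Ψ x 2])
    (f' := ![EuclideanSpace.proj 0 ∘L (L : E3 →L[ℝ] E3), EuclideanSpace.proj 1 ∘L
      (L : E3 →L[ℝ] E3), EuclideanSpace.proj 2 ∘L (K : E3 →L[ℝ] E3)])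
    (inter_mem (Φ.open_source.mem_nhds hp) (Ψ.open_source.mem_nhds hpΨ))
    (by simpa [Fin.forall_fin_succ] using ⟨cΦ 0, cΦ 1, cΨ 2⟩)
    (by simpa [Fin.forall_fin_succ] using
      ⟨hasFDerivAt_coord hL 0, hasFDerivAt_coord hL 1, hasFDerivAt_coord hK 2⟩)
    (fun v hv => by
      have e0 : L v 0 = 0 := hv 0
      have e1 : L v 1 = 0 := hv 1
      have e2 : K v 2 = 0 := hv 2
      have hv' : v ∈ tangentSpace M p := by
        rw [hM.tangentSpace_eq hT hMT hpM]
        exact (hΨ.mem_tangentSpace_iff hpΨ (hMT hpM) hK hK' v).2 e2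
      have e3 := (hΦ.mem_tangentSpace_iff hp hpM hL hL' v).1 hv'
      have : L v = 0 := by
        ext i
        fin_cases i <;> assumption
      simpa using this)
  -- Projection to the plane in the chart Φ. For x ∈ T near p, the point `Φ.symm (r x)` of M has the
  -- same Θ-coordinates as x, hence equals x.
  let r : E3 → E3 := fun x => Φ x - Φ x 2 • EuclideanSpace.single 2 1
  have hr : ContinuousAt r p := by
    have h := Φ.continuousAt hp
    have h2 : ContinuousAt (fun x => Φ x 2) p := (cΦ 2).continuousAt
    exact h.sub (h2.smul continuousAt_const)
  have hrp : r p = Φ p := by simp [r, ((hΦ.2 p hp).1 hpM).1]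
  have hrt : ∀ᶠ x in 𝓝 p, r x ∈ Φ.target :=
    hr.eventually_mem (Φ.open_target.mem_nhds (hrp ▸ Φ.map_source hp))
  have hrs : ∀ᶠ x in 𝓝 p, Φ.symm (r x) ∈ Θ.source := by
    have hc : ContinuousAt Φ.symm (r p) := by
      rw [hrp]
      exact Φ.continuousAt_symm (Φ.map_source hp)
    have hc' : ContinuousAt (fun x => Φ.symm (r x)) p := hc.comp hr
    refine hc'.eventually_mem (Θ.open_source.mem_nhds ?_)
    rwa [hrp, Φ.left_inv hp]
  filter_upwards [hrt, hrs, Θ.open_source.mem_nhds hpΘ,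
    (cΦ 1).continuousAt.eventually_const_lt h1] with x hxt hxs hx hx1 hxT
  have hq : Φ (Φ.symm (r x)) = r x := Φ.right_inv hxt
  have hqM : Φ.symm (r x) ∈ M := by
    refine (hΦ.2 _ (hsub hxs).1).2 ?_
    rw [hq]
    simpa [r] using hx1.le
  have hΨq := (hΨ.2 _ (hsub hxs).2).1 (hMT hqM)
  have hΨx := (hΨ.2 _ (hsub hx).2).1 hxT
  have : Θ x = Θ (Φ.symm (r x)) := by
    ext i
    rw [hΘ, hΘ]
    fin_cases i
    · simp [hq, r]
    · simp [hq, r]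
    · simp [hΨq, hΨx]
  rw [Θ.injOn hx hxs this]
  exact hqM

/-- Otherwise T \ Int S would be a neighbourhood of p in T, yet a curve entering S from p runs in
Int S. -/
theorem coord_eq_zero_of_mem_boundary {S T : Set E3} (hT : IsFlatC1Extension S T)
    {Φ : OpenPartialHomeomorph E3 E3} (hΦ : IsHalfPlaneChart 1 (T \ surfaceInterior S) Φ)
    {p : E3} (hp : p ∈ Φ.source) (hpb : p ∈ boundary S) : Φ p 1 = 0 := by
  have hpM : p ∈ T \ surfaceInterior S := ⟨hT.subset hpb.1, fun h => h.2 hpb⟩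
  by_contra hne
  have hev := eventually_mem_of_coord_pos hT.surface sdiff_subset hT.smooth hΦ hp hpM
    (lt_of_le_of_ne ((hΦ.2 p hp).1 hpM).2 (Ne.symm hne))
  obtain ⟨hpS, Φs, hps, hΦs, h0⟩ := hpb
  replace hΦs := hΦs.of_le (m := 1) (by simp)
  obtain ⟨L, hL, hL'⟩ := hΦs.1.exists_hasFDerivAt hps
  obtain ⟨hc, hc0, hcev⟩ := chartCurve_properties hps hL' (EuclideanSpace.single 1 1)
  have hevc := hc.continuousAt.eventually (by simpa only [hc0] using hev)
  obtain ⟨t, ⟨⟨hts, ht⟩, htM⟩, ht0⟩ :=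
    (((hcev.and hevc).filter_mono (nhdsWithin_le_nhds (s := Ioi 0))).and
      self_mem_nhdsWithin).exists
  have ht0 : 0 < t := ht0
  have hcS : Φs.symm (Φs p + t • EuclideanSpace.single 1 1) ∈ S := by
    refine (hΦs.2 _ hts).2 ?_
    rw [ht]
    simpa [((hΦs.2 p hps).1 hpS).1, h0] using ht0.le
  refine (htM (hT.subset hcS)).2 ⟨hcS, notMem_boundary_of_coord_pos hΦs hts hcS ?_⟩
  rw [ht]
  simpa [h0] using ht0

/-! ### Normal fields -/

/-- A curve of unit vectors proportional to a curve with vanishing velocity is itself stationary. -/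
theorem deriv_eq_zero_of_proportional {a b : ℝ → E3} {a' : E3} (ha : HasDerivAt a a' 0)
    (hb : HasDerivAt b 0 0) (hab : ∀ᶠ t in 𝓝 0, a t = inner ℝ (a t) (b t) • b t)
    (hn : ∀ᶠ t in 𝓝 0, ‖a t‖ = 1) : a' = 0 := by
  have h1 : HasDerivAt (fun t => inner ℝ (a t) (a t)) (inner ℝ (a 0) a' + inner ℝ a' (a 0)) 0 :=
    ha.inner ℝ ha
  have h2 : inner ℝ (a 0) a' + inner ℝ a' (a 0) = 0 := by
    refine h1.unique ((hasDerivAt_const (0 : ℝ) (1 : ℝ)).congr_of_eventuallyEq ?_)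
    filter_upwards [hn] with t ht
    rw [real_inner_self_eq_norm_sq, ht, one_pow]
  have h3 : inner ℝ (a 0) a' = 0 := by
    rw [real_inner_comm (a 0) a'] at h2
    linarith
  -- Differentiating the proportionality makes a' a multiple of b 0, hence of a 0; but a' is
  -- orthogonal to a 0 since a has constant norm.
  have h4 : HasDerivAt (fun t => inner ℝ (a t) (b t) • b t)
      (inner ℝ (a 0) (b 0) • (0 : E3) + (inner ℝ (a 0) (0 : E3) + inner ℝ a' (b 0)) • b 0) 0 :=
    (ha.inner ℝ hb).smul hb
  have h5 : a' = inner ℝ a' (b 0) • b 0 := by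
    have := ha.unique (h4.congr_of_eventuallyEq hab)
    simpa using this
  have h6 := hab.self_of_nhds
  have h7 : inner ℝ (a 0) (b 0) ≠ 0 := by
    intro h
    rw [h, zero_smul] at h6
    have := hn.self_of_nhds
    simp [h6] at this
  rw [h5, inner_smul_right] at h3
  rw [h5, (mul_eq_zero.1 h3).resolve_right h7, zero_smul]

/-- The derivative of a Gauss map is orthogonal to the normal. -/
theorem inner_fderiv_eq_zero {M W : Set E3} {N : E3 → E3} (hW : IsOpen W)
    (hN : IsGaussMapOn M W N) {x : E3} (hx : x ∈ M ∩ W) {v : E3} (hv : v ∈ tangentSpace M x) :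
    inner ℝ (N x) (fderiv ℝ N x v) = 0 := by
  have hd : HasFDerivAt N (fderiv ℝ N x) x :=
    ((hN.1.contDiffAt (hW.mem_nhds hx.2)).differentiableAt (by simp)).hasFDerivAt
  have h := fderiv_eq_zero_of_mem_tangentSpace (M := M) (a := (1 : ℝ)) (hd.inner ℝ hd)
    (by rw [real_inner_self_eq_norm_sq, (hN.2 x hx).1, one_pow])
    (by
      filter_upwards [hW.mem_nhds hx.2] with y hy hyM
      rw [real_inner_self_eq_norm_sq, (hN.2 y ⟨hyM, hy⟩).1, one_pow]) hv
  simp only [ContinuousLinearMap.comp_apply, ContinuousLinearMap.prod_apply,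
    fderivInnerCLM_apply] at h
  rw [real_inner_comm (N x) (fderiv ℝ N x v)] at h
  linarith

/-- Where the Gaussian curvature vanishes, the differential of the Gauss map has a kernel. -/
theorem exists_fderiv_eq_zero {M W : Set E3} {N : E3 → E3} (hM : IsSurfaceWithBoundary M)
    (hW : IsOpen W) (hN : IsGaussMapOn M W N) {x : E3} (hx : x ∈ M ∩ W)
    (hK : gaussianCurvature M N x = 0) :
    ∃ v ∈ tangentSpace M x, v ≠ 0 ∧ fderiv ℝ N x v = 0 := by
  obtain ⟨v, hv, hv0⟩ := (Submodule.ne_bot_iff _).1 (LinearMap.bot_lt_ker_of_det_eq_zero hK).ne'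
  refine ⟨v, v.2, by simpa using hv0, ?_⟩
  -- The derivative is already tangent, so its vanishing after projection is genuine vanishing.
  have hmem : fderiv ℝ N x v ∈ tangentSpace M x :=
    (mem_iff_inner_eq_zero (hM.finrank_tangentSpace hx.1) (hN.2 x hx).1 (hN.2 x hx).2 _).2
      (inner_fderiv_eq_zero hW hN hx v.2)
  have h : (tangentSpace M x).orthogonalProjectionOnto (fderiv ℝ N x v) = 0 := hv
  have h' := Submodule.orthogonalProjectionOnto_mem_subspace_eq_self
    (K := tangentSpace M x) ⟨_, hmem⟩
  rw [h] at h'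
  exact (congrArg Subtype.val h').symm

/-- Two unit normals of the same plane are proportional. -/
theorem eq_inner_smul_of_orthogonal {V : Submodule ℝ E3} (hV : Module.finrank ℝ V = 2) {m n : E3}
    (hn : ‖n‖ = 1) (hnV : ∀ v ∈ V, inner ℝ n v = 0) (hmV : ∀ v ∈ V, inner ℝ m v = 0) :
    m = inner ℝ m n • n := by
  have hd : m - inner ℝ m n • n ∈ V := by
    rw [mem_iff_inner_eq_zero hV hn hnV, inner_sub_right, inner_smul_right,
      real_inner_self_eq_norm_sq, hn, real_inner_comm]
    ring
  have h1 := hmV _ hd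
  have h2 := hnV _ hd
  have h3 : inner ℝ (m - inner ℝ m n • n) (m - inner ℝ m n • n) = 0 := by
    nth_rewrite 1 [inner_sub_left]
    rw [inner_smul_left, h1, h2]
    simp
  exact sub_eq_zero.1 (inner_self_eq_zero.1 h3)

/-- The Gauss map of the flat part is immersive along the common boundary. -/
theorem fderiv_ne_zero_of_immersive {S T : Set E3} (hS : IsSurfaceWithBoundary S)
    (hT : IsFlatC1Extension S T) (hg : GaussMapImmersiveAlong S (boundary S))
    {Φ : OpenPartialHomeomorph E3 E3} (hΦ : IsHalfPlaneChart 1 (T \ surfaceInterior S) Φ)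
    {p : E3} (hp : p ∈ Φ.source) (hpb : p ∈ boundary S) {W : Set E3} {N : E3 → E3}
    (hW : IsOpen W) (hpW : p ∈ W) (hN : IsGaussMapOn (T \ surfaceInterior S) W N)
    {L : E3 ≃L[ℝ] E3} (hL' : HasFDerivAt Φ.symm (L.symm : E3 →L[ℝ] E3) (Φ p)) :
    fderiv ℝ N p (L.symm (EuclideanSpace.single 0 1)) ≠ 0 := by
  intro hzero
  have hpM : p ∈ T \ surfaceInterior S := ⟨hT.subset hpb.1, fun h => h.2 hpb⟩
  have hp1 := coord_eq_zero_of_mem_boundary hT hΦ hp hpb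
  have hp2 := ((hΦ.2 p hp).1 hpM).1
  obtain ⟨Ws, Ns, hWs, hpWs, hNs, himm⟩ := hg p hpb
  obtain ⟨-, Φs, hps, hΦs, -⟩ := id hpb
  obtain ⟨hc, hc0, hcev⟩ := chartCurve_properties hp hL' (EuclideanSpace.single 0 1)
  set c : ℝ → E3 := fun t => Φ.symm (Φ p + t • EuclideanSpace.single 0 1) with hcdef
  replace hc0 : c 0 = p := hc0
  have hcc : Tendsto c (𝓝 0) (𝓝 p) := by simpa only [hc0] using hc.continuousAt.tendsto
  -- The chart line y₁ = y₂ = 0 lies in ∂S, so both normals are defined along it and can be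
  -- compared.
  have hmem : ∀ᶠ t in 𝓝 0, c t ∈ (T \ surfaceInterior S) ∩ W ∧ c t ∈ boundary S ∩ Ws := by
    filter_upwards [hcev, hcc.eventually_mem (hW.mem_nhds hpW),
      hcc.eventually_mem (hWs.mem_nhds hpWs),
      hcc.eventually_mem (Φs.open_source.mem_nhds hps)] with t ht htW htWs hts
    have ht2 : Φ (c t) = Φ p + t • EuclideanSpace.single 0 1 := ht.2
    have htM : c t ∈ T \ surfaceInterior S := by
      refine (hΦ.2 _ ht.1).2 ?_
      rw [ht2]
      simp [hp1, hp2]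
    refine ⟨⟨htM, htW⟩, ?_, htWs⟩
    refine mem_boundary_of_coord_eq_zero hT.surface hΦ hΦs ht.1 hts htM ?_
    rw [ht2]
    simp [hp1]
  have hv : L.symm (EuclideanSpace.single 0 1) ∈ tangentSpace (boundary S) p := by
    have := mem_tangentSpace_of_curve (M := boundary S) hc
      ((hmem.mono fun t ht => ht.2.1).filter_mono nhdsWithin_le_nhds)
    rwa [hc0] at this
  refine himm _ hv (by simp) ?_
  have hdN : HasFDerivAt N (fderiv ℝ N p) (c 0) := by
    rw [hc0]
    exact ((hN.1.contDiffAt (hW.mem_nhds hpW)).differentiableAt (by simp)).hasFDerivAt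
  have hdNs : HasFDerivAt Ns (fderiv ℝ Ns p) (c 0) := by
    rw [hc0]
    exact ((hNs.1.contDiffAt (hWs.mem_nhds hpWs)).differentiableAt (by simp)).hasFDerivAt
  have hb := hdN.comp_hasDerivAt (0 : ℝ) hc
  rw [hzero] at hb
  refine deriv_eq_zero_of_proportional (hdNs.comp_hasDerivAt (0 : ℝ) hc) hb ?_ ?_
  · filter_upwards [hmem] with t ht
    refine eq_inner_smul_of_orthogonal (hT.smooth.finrank_tangentSpace ht.1.1)
      (hN.2 _ ht.1).1 (hN.2 _ ht.1).2 ?_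
    rw [hT.smooth.tangentSpace_eq hT.surface sdiff_subset ht.1.1,
      ← hS.tangentSpace_eq hT.surface hT.subset ht.2.1.1]
    exact (hNs.2 _ ⟨ht.2.1.1, ht.2.2⟩).2
  · filter_upwards [hmem] with t ht using (hNs.2 _ ⟨ht.2.1.1, ht.2.2⟩).1

/-! ### Adapted charts and constancy of the tangent plane -/

/-- A boundary chart of the flat part, near a boundary point, whose first coordinate is a linear
function of the Gauss map. -/
theorem exists_adapted_chart {S T : Set E3} (hS : IsSurfaceWithBoundary S)
    (hT : IsFlatC1Extension S T) (hg : GaussMapImmersiveAlong S (boundary S))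
    {p : E3} (hpb : p ∈ boundary S) {W : Set E3} {N : E3 → E3}
    (hW : IsOpen W) (hpW : p ∈ W) (hN : IsGaussMapOn (T \ surfaceInterior S) W N)
    {s : Set E3} (hs : s ∈ 𝓝 p) :
    ∃ (Θ : OpenPartialHomeomorph E3 E3) (w : E3), p ∈ Θ.source ∧ Θ.source ⊆ s ∧
      IsHalfPlaneChart 1 (T \ surfaceInterior S) Θ ∧ ∀ x, Θ x 0 = inner ℝ w (N x) := by
  have hpM : p ∈ T \ surfaceInterior S := ⟨hT.subset hpb.1, fun h => h.2 hpb⟩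
  obtain ⟨Φ, hp, hΦ⟩ := hT.smooth p hpM
  replace hΦ := hΦ.of_le (m := 1) (by simp)
  obtain ⟨L, hL, hL'⟩ := hΦ.1.exists_hasFDerivAt hp
  have hne := fderiv_ne_zero_of_immersive hS hT hg hΦ hp hpb hW hpW hN hL'
  -- With this w, the derivative of ⟨w, N⟩ along the boundary direction is ‖w‖² ≠ 0, so it can
  -- replace the coordinate y₀.
  set w := fderiv ℝ N p (L.symm (EuclideanSpace.single 0 1)) with hw
  have cN : ContDiffAt ℝ 1 N p := (hN.1.contDiffAt (hW.mem_nhds hpW)).of_le (by simp)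
  have dN := (cN.differentiableAt one_ne_zero).hasFDerivAt
  have cΦ : ∀ i, ContDiffAt ℝ 1 (fun x => Φ x i) p := fun i =>
    contDiffAt_euclidean.1 (hΦ.1.1.contDiffAt (Φ.open_source.mem_nhds hp)) i
  obtain ⟨Θ, hΘ, hpΘ, hsub, hd⟩ := exists_isDiffeoOn_coords
    (f := ![fun x => inner ℝ w (N x), fun x => Φ x 1, fun x => Φ x 2])
    (f' := ![innerSL ℝ w ∘L fderiv ℝ N p, EuclideanSpace.proj 1 ∘L
      (L : E3 →L[ℝ] E3), EuclideanSpace.proj 2 ∘L (L : E3 →L[ℝ] E3)])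
    (inter_mem hs (Φ.open_source.mem_nhds hp))
    (by simpa [Fin.forall_fin_succ] using ⟨contDiffAt_const.inner ℝ cN, cΦ 1, cΦ 2⟩)
    (by simpa [Fin.forall_fin_succ] using
      ⟨(innerSL ℝ w).hasFDerivAt.comp p dN, hasFDerivAt_coord hL 1, hasFDerivAt_coord hL 2⟩)
    (fun v hv => by
      have e0 : inner ℝ w (fderiv ℝ N p v) = 0 := hv 0
      have e1 : L v 1 = 0 := hv 1
      have e2 : L v 2 = 0 := hv 2
      have hLv : L v = L v 0 • EuclideanSpace.single 0 1 := by
        ext i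
        fin_cases i <;> simp [e1, e2]
      have hv' : v = L v 0 • L.symm (EuclideanSpace.single 0 1) := by
        rw [← map_smul, ← hLv, L.symm_apply_apply]
      rw [hv', map_smul, ← hw, inner_smul_right] at e0
      have := (mul_eq_zero.1 e0).resolve_right (by simpa using hne)
      rw [hv', this, zero_smul])
  refine ⟨Θ, w, hpΘ, fun x hx => (hsub hx).1, ⟨hd, fun x hx => ?_⟩, fun x => hΘ x 0⟩
  have e1 : Θ x 1 = Φ x 1 := hΘ x 1
  have e2 : Θ x 2 = Φ x 2 := hΘ x 2
  rw [e1, e2]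
  exact hΦ.2 x (hsub hx).2

/-- On a flat surface, the Gauss map is stationary in the directions transverse to its level
function in an adapted chart. -/
theorem fderiv_eq_zero_of_flat {M W : Set E3} {N : E3 → E3} (hM : IsSurfaceWithBoundary M)
    (hW : IsOpen W) (hN : IsGaussMapOn M W N) {x : E3} (hx : x ∈ M ∩ W)
    (hK : gaussianCurvature M N x = 0) {Θ : OpenPartialHomeomorph E3 E3}
    (hΘ : IsHalfPlaneChart 1 M Θ) (hxs : x ∈ Θ.source) {w : E3}
    (hw : ∀ y, Θ y 0 = inner ℝ w (N y)) {L : E3 ≃L[ℝ] E3}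
    (hL : HasFDerivAt Θ (L : E3 →L[ℝ] E3) x)
    (hL' : HasFDerivAt Θ.symm (L.symm : E3 →L[ℝ] E3) (Θ x)) :
    fderiv ℝ N x (L.symm (EuclideanSpace.single 1 1)) = 0 := by
  obtain ⟨v, hv, hv0, hNv⟩ := exists_fderiv_eq_zero hM hW hN hx hK
  have e2 := (hΘ.mem_tangentSpace_iff hxs hx.1 hL hL' v).1 hv
  have dN : HasFDerivAt N (fderiv ℝ N x) x :=
    ((hN.1.contDiffAt (hW.mem_nhds hx.2)).differentiableAt (by simp)).hasFDerivAt
  -- The coordinate y₀ is a function of N alone, so a direction killed by dN kills it too.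
  have e0 : L v 0 = 0 := by
    have h1 := hasFDerivAt_coord hL 0
    have h2 : HasFDerivAt (fun y => Θ y 0) (innerSL ℝ w ∘L fderiv ℝ N x) x := by
      simp only [hw]
      exact (innerSL ℝ w).hasFDerivAt.comp x dN
    have := DFunLike.congr_fun (h1.unique h2) v
    simpa [hNv] using this
  have hLv : L v = L v 1 • EuclideanSpace.single 1 1 := by
    ext i
    fin_cases i <;> simp [e0, e2]
  have hv' : v = L v 1 • L.symm (EuclideanSpace.single 1 1) := by
    rw [← map_smul, ← hLv, L.symm_apply_apply]
  rw [hv', map_smul] at hNv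
  refine (smul_eq_zero.1 hNv).resolve_left fun h => hv0 ?_
  rw [hv', h, zero_smul]

/-- Along the coordinate lines `y₁ ↦ (y₀, y₁, 0)` of an adapted chart of a flat surface, the
tangent plane is constant. -/
theorem normal_eq_along_line {M W : Set E3} {N : E3 → E3} (hM : IsSurfaceWithBoundary M)
    (hW : IsOpen W) (hN : IsGaussMapOn M W N) (hK : ∀ x ∈ M ∩ W, gaussianCurvature M N x = 0)
    {Θ : OpenPartialHomeomorph E3 E3} (hΘ : IsHalfPlaneChart 1 M Θ) (hsub : Θ.source ⊆ W)
    {w : E3} (hw : ∀ y, Θ y 0 = inner ℝ w (N y)) {z : E3} (hz1 : z 1 = 0) (hz2 : z 2 = 0)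
    {b : ℝ} (hb : 0 ≤ b) (hline : ∀ t ∈ Icc 0 b, z + t • EuclideanSpace.single 1 1 ∈ Θ.target) :
    N (Θ.symm (z + b • EuclideanSpace.single 1 1)) = N (Θ.symm z) ∧
      inner ℝ (N (Θ.symm z)) (Θ.symm (z + b • EuclideanSpace.single 1 1) - Θ.symm z) = 0 := by
  set q : ℝ → E3 := fun t => Θ.symm (z + t • EuclideanSpace.single 1 1) with hq
  have hq0 : q 0 = Θ.symm z := by simp [hq]
  have hmem : ∀ t ∈ Icc 0 b, q t ∈ Θ.source ∧ q t ∈ M ∩ W := by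
    intro t ht
    have hs : q t ∈ Θ.source := Θ.map_target (hline t ht)
    refine ⟨hs, (hΘ.2 _ hs).2 ?_, hsub hs⟩
    rw [show Θ (q t) = _ from Θ.right_inv (hline t ht)]
    simpa [hz1, hz2] using ht.1
  have hder : ∀ t ∈ Icc 0 b, ∃ X : E3, HasDerivAt q X t ∧ X ∈ tangentSpace M (q t) ∧
      fderiv ℝ N (q t) X = 0 := by
    intro t ht
    obtain ⟨hs, hqM⟩ := hmem t ht
    obtain ⟨L, hL, hL'⟩ := hΘ.1.exists_hasFDerivAt hs
    refine ⟨L.symm (EuclideanSpace.single 1 1), ?_, ?_, ?_⟩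
    · have hl : HasDerivAt (fun t : ℝ => z + t • (EuclideanSpace.single 1 1 : E3))
          (EuclideanSpace.single 1 1) t := by
        simpa using ((hasDerivAt_id t).smul_const (EuclideanSpace.single 1 1 : E3)).const_add z
      rw [show Θ (q t) = _ from Θ.right_inv (hline t ht)] at hL'
      exact hL'.comp_hasDerivAt t hl
    · exact (hΘ.mem_tangentSpace_iff hs hqM.1 hL hL' _).2 (by simp)
    · exact fderiv_eq_zero_of_flat hM hW hN hqM (hK _ hqM) hΘ hs hw hL hL'
  have hNder : ∀ t ∈ Icc 0 b, HasDerivAt (fun t => N (q t)) 0 t := by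
    intro t ht
    obtain ⟨X, hX, -, hX0⟩ := hder t ht
    have dN : HasFDerivAt N (fderiv ℝ N (q t)) (q t) :=
      ((hN.1.contDiffAt (hW.mem_nhds (hmem t ht).2.2)).differentiableAt (by simp)).hasFDerivAt
    rw [← hX0]
    exact dN.comp_hasDerivAt t hX
  have hNc : ∀ t ∈ Icc 0 b, N (q t) = N (q 0) :=
    constant_of_has_deriv_right_zero (fun t ht => (hNder t ht).continuousAt.continuousWithinAt)
      fun t ht => (hNder t (Ico_subset_Icc_self ht)).hasDerivWithinAt
  -- Besides the normal direction, the offset of the tangent plane must be constant: the velocity is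
  -- tangent, so orthogonal to the constant normal.
  have hIder : ∀ t ∈ Icc 0 b, HasDerivAt (fun t => inner ℝ (N (q 0)) (q t)) 0 t := by
    intro t ht
    obtain ⟨X, hX, hXT, -⟩ := hder t ht
    have h0 : inner ℝ (N (q 0)) X = 0 := by
      rw [← hNc t ht]
      exact (hN.2 _ (hmem t ht).2).2 X hXT
    have h : HasDerivAt (fun t => inner ℝ (N (q 0)) (q t)) (inner ℝ (N (q 0)) X) t :=
      (innerSL ℝ (N (q 0))).hasFDerivAt.comp_hasDerivAt t hX
    rwa [h0] at h
  have hIc : ∀ t ∈ Icc 0 b, inner ℝ (N (q 0)) (q t) = inner ℝ (N (q 0)) (q 0) :=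
    constant_of_has_deriv_right_zero (fun t ht => (hIder t ht).continuousAt.continuousWithinAt)
      fun t ht => (hIder t (Ico_subset_Icc_self ht)).hasDerivWithinAt
  rw [← hq0]
  exact ⟨hNc b ⟨hb, le_rfl⟩, by rw [inner_sub_right, hIc b ⟨hb, le_rfl⟩, sub_self]⟩

/-! ### Projective tangent planes -/

theorem projectiveTangentSpace_eq {M M' : Set E3} {x y : E3}
    (h : tangentSpace M x = tangentSpace M' y) (hxy : x - y ∈ tangentSpace M x) :
    projectiveTangentSpace M x = projectiveTangentSpace M' y := by
  have key : ∀ {V : Submodule ℝ E3} {a b : E3}, a - b ∈ V →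
      Submodule.span ℝ {((1 : ℝ), a)} ⊔ V.map (LinearMap.inr ℝ ℝ E3) ≤
        Submodule.span ℝ {((1 : ℝ), b)} ⊔ V.map (LinearMap.inr ℝ ℝ E3) := by
    intro V a b hab
    refine sup_le ?_ le_sup_right
    rw [Submodule.span_singleton_le_iff_mem]
    have : ((1 : ℝ), a) = (1, b) + LinearMap.inr ℝ ℝ E3 (a - b) := by simp
    rw [this]
    exact Submodule.add_mem_sup (Submodule.mem_span_singleton_self _)
      (Submodule.mem_map_of_mem hab)
  rw [projectiveTangentSpace, projectiveTangentSpace, ← h]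
  exact le_antisymm (key hxy) (key (by simpa using neg_mem hxy))

/-- A plane that is tangent at `y` lifts to a point of the incidence manifold over `y`. -/
theorem exists_incidence {M : Set E3} {y : E3} {Y : RP3Dual}
    (h : LinearMap.ker Y.rep = projectiveTangentSpace M y) :
    ∃ z : Incidence, proj₁ z = affinePoint y ∧ proj₂ z = Y := by
  refine ⟨⟨(affinePoint y, Y), ?_⟩, rfl, rfl⟩
  have hmem : ((1 : ℝ), y) ∈ LinearMap.ker Y.rep := by
    rw [h]
    exact Submodule.mem_sup_left (Submodule.mem_span_singleton_self _)
  -- The chosen representative differs from (1, y) by a unit, which does not affect incidence.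
  obtain ⟨a, ha⟩ := Projectivization.exists_smul_eq_mk_rep ℝ ((1 : ℝ), y)
    (fun h => one_ne_zero (congrArg Prod.fst h))
  change Y.rep (Projectivization.rep (Projectivization.mk ℝ ((1 : ℝ), y) _)) = 0
  rw [← ha, Units.smul_def, map_smul, LinearMap.mem_ker.1 hmem, smul_zero]

theorem affinePoint_injective : Function.Injective affinePoint := by
  intro x y h
  obtain ⟨a, ha⟩ := (Projectivization.mk_eq_mk_iff' ℝ _ _ _ _).1 h
  have h1 := congrArg Prod.fst ha
  have h2 := congrArg Prod.snd ha
  simp only [Prod.smul_mk, smul_eq_mul, mul_one] at h1 h2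
  rw [← h2, h1, one_smul]

/-- Moving the second coordinate towards that of the centre, which is 0, does not increase the
distance to the centre. Hence the line back to the boundary stays in the ball. -/
theorem segment_mem_ball {a x : E3} {r : ℝ} (ha : a 1 = 0) (hx : x ∈ Metric.ball a r)
    {t : ℝ} (ht : t ∈ Icc 0 (x 1)) :
    x - x 1 • EuclideanSpace.single 1 1 + t • EuclideanSpace.single 1 1 ∈ Metric.ball a r := by
  rw [Metric.mem_ball] at hx ⊢
  refine lt_of_le_of_lt ?_ hx
  rw [EuclideanSpace.dist_eq, EuclideanSpace.dist_eq]
  refine Real.sqrt_le_sqrt ?_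
  have h := pow_le_pow_left₀ ht.1 ht.2 2
  simpa [Fin.sum_univ_three, Real.dist_eq, sq_abs, ha] using h

/-- Near a boundary point, every tangent plane of the flat part is a tangent plane at some
nearby boundary point. -/
theorem exists_neighborhood_tangent_eq {S T : Set E3} (hS : IsSurfaceWithBoundary S)
    (hT : IsFlatC1Extension S T) (hg : GaussMapImmersiveAlong S (boundary S))
    {p : E3} (hpb : p ∈ boundary S) :
    ∃ V : Set E3, IsOpen V ∧ p ∈ V ∧ ∀ x ∈ V ∩ (T \ surfaceInterior S),
      ∃ y ∈ V ∩ boundary S, tangentSpace T x = tangentSpace T y ∧ x - y ∈ tangentSpace T x := by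
  have hpM : p ∈ T \ surfaceInterior S := ⟨hT.subset hpb.1, fun h => h.2 hpb⟩
  obtain ⟨W, N, hW, hpW, hN, hK⟩ := hT.flat p hpM
  obtain ⟨-, Φs, hps, hΦs, -⟩ := id hpb
  obtain ⟨Θ, w, hp, hsub, hΘ, hw⟩ := exists_adapted_chart hS hT hg hpb hW hpW hN
    (inter_mem (hW.mem_nhds hpW) (Φs.open_source.mem_nhds hps))
  have hp1 := coord_eq_zero_of_mem_boundary hT hΘ hp hpb
  -- Taking V as the preimage of a ball centred on the boundary keeps the foot of each line in V,
  -- which the equality over U ∩ ∂S requires.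
  obtain ⟨r, hr, hball⟩ := Metric.isOpen_iff.1 Θ.open_target _ (Θ.map_source hp)
  have hVo : IsOpen (Θ.source ∩ Θ ⁻¹' Metric.ball (Θ p) r) :=
    Θ.isOpen_inter_preimage Metric.isOpen_ball
  have hpV : p ∈ Θ.source ∩ Θ ⁻¹' Metric.ball (Θ p) r :=
    ⟨hp, mem_preimage.2 (Metric.mem_ball_self hr)⟩
  refine ⟨_, hVo, hpV, ?_⟩
  rintro x ⟨⟨hxs, hxr⟩, hxM⟩
  obtain ⟨hx2, hx1⟩ := (hΘ.2 x hxs).1 hxM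
  -- Coordinates of the foot: same y₀ as x, but y₁ = 0.
  set z : E3 := Θ x - Θ x 1 • EuclideanSpace.single 1 1 with hz
  have hz1 : z 1 = 0 := by simp [hz]
  have hz2 : z 2 = 0 := by simp [hz, hx2]
  have hzx : z + Θ x 1 • EuclideanSpace.single 1 1 = Θ x := by simp [hz]
  have hline : ∀ t ∈ Icc 0 (Θ x 1),
      z + t • EuclideanSpace.single 1 1 ∈ Metric.ball (Θ p) r :=
    fun t ht => segment_mem_ball hp1 hxr ht
  have hz0 : z ∈ Metric.ball (Θ p) r := by simpa using hline 0 ⟨le_rfl, hx1⟩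
  obtain ⟨hN1, hN2⟩ := normal_eq_along_line hT.smooth hW hN hK hΘ (fun y hy => (hsub hy).1) hw
    hz1 hz2 hx1 fun t ht => hball (hline t ht)
  rw [hzx, Θ.left_inv hxs] at hN1 hN2
  have hys : Θ.symm z ∈ Θ.source := Θ.map_target (hball hz0)
  have hΘy : Θ (Θ.symm z) = z := Θ.right_inv (hball hz0)
  have hyM : Θ.symm z ∈ T \ surfaceInterior S := by
    refine (hΘ.2 _ hys).2 ?_
    rw [hΘy]
    exact ⟨hz2, hz1.ge⟩
  have hyb : Θ.symm z ∈ boundary S :=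
    mem_boundary_of_coord_eq_zero hT.surface hΘ hΦs hys (hsub hys).2 hyM (by rw [hΘy, hz1])
  have tmem : ∀ u ∈ (T \ surfaceInterior S) ∩ W, ∀ v,
      v ∈ tangentSpace T u ↔ inner ℝ (N u) v = 0 := by
    intro u hu v
    rw [← hT.smooth.tangentSpace_eq hT.surface sdiff_subset hu.1]
    exact mem_iff_inner_eq_zero (hT.smooth.finrank_tangentSpace hu.1) (hN.2 u hu).1
      (hN.2 u hu).2 v
  have tx := tmem x ⟨hxM, (hsub hxs).1⟩
  have ty := tmem _ ⟨hyM, (hsub hys).1⟩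
  refine ⟨Θ.symm z, ⟨⟨hys, by simpa only [mem_preimage, hΘy] using hz0⟩, hyb⟩, ?_, ?_⟩
  · ext v
    rw [tx, ty, hN1]
  · rw [tx, hN1]
    exact hN2

end FlatExtension

/-! ### Passage to Legendre lifts -/

open FlatExtension in
theorem mainTheorem10 (S T : Set FlatExtension.E3)
    (hS : FlatExtension.IsSurfaceWithBoundary S)
    (hT : FlatExtension.IsFlatC1Extension S T)
    (hg : FlatExtension.GaussMapImmersiveAlong S (FlatExtension.boundary S)) :
    ∀ p ∈ FlatExtension.boundary S, ∃ U : Set FlatExtension.E3,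
      p ∈ U ∧
      (∃ W : Set FlatExtension.E3, IsOpen W ∧
        U = W ∩ (T \ FlatExtension.surfaceInterior S)) ∧
      FlatExtension.proj₂ '' FlatExtension.legendreLift U ⊆ FlatExtension.dualBoundary S ∧
      FlatExtension.proj₂ '' FlatExtension.legendreLift U =
        FlatExtension.proj₂ '' {z ∈ FlatExtension.boundaryLift S |
          FlatExtension.proj₁ z ∈ FlatExtension.affinePoint '' U} := by
  intro p hpb
  have hbM : ∀ y ∈ boundary S, y ∈ T \ surfaceInterior S :=
    fun y hy => ⟨hT.subset hy.1, fun h => h.2 hy⟩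
  obtain ⟨V, hV, hpV, hVt⟩ := exists_neighborhood_tangent_eq hS hT hg hpb
  have hU : ∀ x ∈ V ∩ (T \ surfaceInterior S),
      tangentSpace (V ∩ (T \ surfaceInterior S)) x = tangentSpace T x := fun x hx => by
    rw [tangentSpace_inter_open hV hx.1, hT.smooth.tangentSpace_eq hT.surface sdiff_subset hx.2]
  have hSt : ∀ y ∈ boundary S, tangentSpace S y = tangentSpace T y := fun y hy =>
    hS.tangentSpace_eq hT.surface hT.subset hy.1
  have heq : proj₂ '' legendreLift (V ∩ (T \ surfaceInterior S)) =
      proj₂ '' {z ∈ boundaryLift S | proj₁ z ∈ affinePoint '' (V ∩ (T \ surfaceInterior S))} := by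
    apply Subset.antisymm
    -- The plane at x is also the plane of S at the foot y, so it lifts to a point of the boundary
    -- lift over y.
    · rintro _ ⟨z, ⟨x, hx, -, hz⟩, rfl⟩
      obtain ⟨y, ⟨hyV, hyb⟩, hty, hxy⟩ := hVt x hx
      rw [projectiveTangentSpace_eq (M' := S) (y := y) (by rw [hU x hx, hty, hSt y hyb])
        (by rwa [hU x hx])] at hz
      obtain ⟨z', hz1, hz2⟩ := exists_incidence hz
      exact ⟨z', ⟨⟨⟨y, hyb.1, hz1, by rwa [hz2]⟩, y, hyb, hz1.symm⟩,
        y, ⟨hyV, hbM y hyb⟩, hz1.symm⟩, hz2⟩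
    -- Here the same incidence point works, since S and U have the same tangent plane on ∂S; the
    -- three base points coincide by injectivity of `affinePoint`.
    · rintro _ ⟨z, ⟨⟨⟨y, hyS, hz1, hz2⟩, y', hyb, hy'⟩, x, hx, hxz⟩, rfl⟩
      obtain rfl : y' = y := affinePoint_injective (hy'.trans hz1)
      obtain rfl : x = y' := affinePoint_injective (hxz.trans hz1)
      refine ⟨z, ⟨x, hx, hz1, ?_⟩, rfl⟩
      rw [hz2]
      exact projectiveTangentSpace_eq (by rw [hU x hx, hSt x hyb]) (by simp)
  refine ⟨V ∩ (T \ surfaceInterior S), ⟨hpV, hbM p hpb⟩, ⟨V, hV, rfl⟩, ?_, heq⟩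
  rw [heq]
  exact image_mono fun z hz => hz.1

end
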